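/- Let $f\in L^1[-\pi,\pi]$ be real-valued with $\int_{-\pi}^{\pi}f(x)\,dx=\int_{-\pi}^{\pi}xf(x)\,dx=0$. Let $f^{\#}$ denote the symmetric decreasing rearrangement of $f$ on $[-\pi,\pi]$, that is, $f^{\#}(x)=f^{*}(2|x|)$, where $f^{*}(t)=\inf\{s\in\mathbb{R}:|\{x\in[-\pi,\pi]:f(x)>s\}|\le t\}$ for $0<t<2\pi$, $f^{*}(0)=\operatorname{ess\,sup} f$ and $f^{*}(2\pi)=\operatorname{ess\,inf} f$. Suppose that $u$ and $v$ solve the Neumann problems $$-u''=f \ \text{ in } (-\pi,\pi),\qquad u'(-\pi)=u'(\pi)=0,\qquad \int_{-\pi}^{\pi}u\,dx=0,$$ $$-v''=f^{\#} \ \text{ in } (-\pi,\pi),\qquad v'(-\pi)=v'(\pi)=0,\qquad \int_{-\pi}^{\pi}v\,dx=0,$$ in the sense that $u,v\in C^1[-\pi,\pi]$, $u'$ and $v'$ are absolutely continuous on $[-\pi,\pi]$, and the differential equations hold almost everywhere. For $w\in L^1[-\pi,\pi]$ and $0\le t\le 2\pi$ let $w^{\bigstar}(t)=\sup\int_E w\,dx$,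 the supremum being over all measurable sets $E\subseteq[-\pi,\pi]$ of length $|E|=t$. Then $$u^{\bigstar}(t)\ \le\ \int_{-t/2}^{t/2}v(x)\,dx\ \le\ v^{\bigstar}(t)\qquad\text{for all } t\in[0,2\pi].$$ -/

import Mathlib

open MeasureTheory Set

noncomputable section

/-- The decreasing rearrangement `f^*` of `f : X → ℝ`, as an extended real function. It is meant
for `t ∈ [0, |X|]`: the essential supremum at `t = 0`, the essential infimum at `t = |X|`, and
`inf {s : |{x ∈ X : s < f x}| ≤ t}` in between. -/
def decreasingRearrangement (X : Set ℝ) (f : ℝ → ℝ) (t : ℝ) : EReal :=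
  open Classical in
  if t = 0 then essSup (fun x => (f x : EReal)) (volume.restrict X)
  else if ENNReal.ofReal t = volume X then essInf (fun x => (f x : EReal)) (volume.restrict X)
  else sInf {a : EReal | ∃ s : ℝ, volume {x ∈ X | s < f x} ≤ ENNReal.ofReal t ∧ a = (s : EReal)}

/-- The symmetric decreasing rearrangement `f^#(x) = f^*(2|x|)`, for `|x| ≤ |X| / 2`. -/
def symmDecreasingRearrangement (X : Set ℝ) (f : ℝ → ℝ) (x : ℝ) : EReal :=
  decreasingRearrangement X f (2 * |x|)

/-- The star function `f^★(t)`: the supremum of `∫_E f` over all measurable `E ⊆ X` of length `t`.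
For `f ∈ L¹(X)` and `0 ≤ t ≤ |X| < ∞` this is the supremum of a nonempty bounded set. -/
def starFunction (X : Set ℝ) (f : ℝ → ℝ) (t : ℝ) : ℝ :=
  sSup {a : ℝ | ∃ E : Set ℝ, MeasurableSet E ∧ E ⊆ X ∧ volume E = ENNReal.ofReal t ∧
    a = ∫ x in E, f x}

/-- `u` is the zero-mean solution of `-u'' = f` in `(-π, π)`, `u'(-π) = u'(π) = 0`:
`u ∈ C¹[-π, π]` (one-sided derivatives at the end points), `u'` is absolutely continuous on
`[-π, π]`, and `u''(x)` exists and equals `-f x` for almost every `x ∈ (-π, π)`. -/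
structure IsZeroMeanNeumannSolution (f u : ℝ → ℝ) : Prop where
  contDiffOn : ContDiffOn ℝ 1 u (Icc (-Real.pi) Real.pi)
  absolutelyContinuous_deriv : AbsolutelyContinuousOnInterval
    (derivWithin u (Icc (-Real.pi) Real.pi)) (-Real.pi) Real.pi
  equation : ∀ᵐ x ∂(volume.restrict (Ioo (-Real.pi) Real.pi)),
    HasDerivAt (derivWithin u (Icc (-Real.pi) Real.pi)) (-(f x)) x
  deriv_left : derivWithin u (Icc (-Real.pi) Real.pi) (-Real.pi) = 0
  deriv_right : derivWithin u (Icc (-Real.pi) Real.pi) Real.pi = 0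
  zero_mean : ∫ x in (-Real.pi)..Real.pi, u x = 0

end

/-! Write `u^*`, `f^*` for decreasing rearrangements and `F(τ) = ∫_0^τ f^*`. The vanishing first
moment of `f` gives `u(-π) = u(π)`, so `u` crosses every gap between two of its values at least
twice. Let `Φ` truncate smoothly between the levels `u^*(t')` and `u^*(t)`, with height `H` and `ψ =
Φ'`. Crossing twice, Cauchy–Schwarz and testing the equation with `Φ ∘ u` give `4H² ≤ (∫ψ(u)) (∫Φ(u)
f)`. The first factor is at most `t' - t` by equimeasurability; by the bathtub principle the second
is at most `H` times the maximum of `F` on `[t, t']`. Hence `-(u^*)' ≤ F/4` in difference form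
(`four_mul_decreasingRearrangement_sub_le`).

For `v` there is equality: `w(s) = (v(s/2) + v(-s/2))/2` satisfies `-w' = F/4`. So `u^* - w` is
nondecreasing with zero integral over `(0, 2π)`, and its integral over `(0, t)` is nonpositive. This
bounds `∫_0^t u^*`, which dominates `u^★(t)`, by `∫_{-t/2}^{t/2} v`. The second inequality takes `E
= [-t/2, t/2]`. -/

/-! ### Decreasing rearrangement: equimeasurability and the bathtub principle. -/

section Rearrangement

variable {X : Set ℝ} {h : ℝ → ℝ} {L : ℝ}

theorem coe_lt_decreasingRearrangement_iff {t : ℝ} (ht : t ≠ 0)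
    (htX : ENNReal.ofReal t ≠ volume X) (s : ℝ) :
    (s : EReal) < decreasingRearrangement X h t ↔
      ENNReal.ofReal t < volume {x ∈ X | s < h x} := by
  rw [decreasingRearrangement, if_neg ht, if_neg htX]
  constructor
  · intro hs
    by_contra! hle
    exact hs.not_ge (sInf_le ⟨s, hle, rfl⟩)
  · intro hs
    -- Continuity from below leaves room to raise the level `s` slightly, which makes the inequality
    -- for the infimum strict.
    have hU : {x ∈ X | s < h x} = ⋃ n : ℕ, {x ∈ X | s + 1 / ((n : ℝ) + 1) < h x} := by
      ext x
      simp only [mem_ofPred_eq, mem_iUnion]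
      constructor
      · rintro ⟨hx, hsx⟩
        obtain ⟨n, hn⟩ := exists_nat_one_div_lt (sub_pos.2 hsx)
        exact ⟨n, hx, by linarith⟩
      · rintro ⟨n, hx, hn⟩
        have : (0 : ℝ) < 1 / ((n : ℝ) + 1) := by positivity
        exact ⟨hx, by linarith⟩
    have hmono : Monotone fun n : ℕ => {x ∈ X | s + 1 / ((n : ℝ) + 1) < h x} := by
      intro m n hmn x hx
      have : 1 / ((n : ℝ) + 1) ≤ 1 / ((m : ℝ) + 1) := Nat.one_div_le_one_div hmn
      exact ⟨hx.1, by linarith [hx.2]⟩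
    rw [hU, hmono.measure_iUnion, lt_iSup_iff] at hs
    obtain ⟨n, hn⟩ := hs
    have hpos : (0 : ℝ) < 1 / ((n : ℝ) + 1) := by positivity
    refine lt_of_lt_of_le (b := ((s + 1 / ((n : ℝ) + 1) : ℝ) : EReal))
      (by exact_mod_cast lt_add_of_pos_right s hpos) (le_sInf ?_)
    rintro _ ⟨r, hr, rfl⟩
    by_contra! hlt
    have hlt' : r < s + 1 / ((n : ℝ) + 1) := by exact_mod_cast hlt
    have hsub : {x ∈ X | s + 1 / ((n : ℝ) + 1) < h x} ⊆ {x ∈ X | r < h x} :=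
      fun x hx => ⟨hx.1, hlt'.trans hx.2⟩
    exact (hn.trans_le (measure_mono hsub)).not_ge hr

theorem decreasingRearrangement_ne_bot {t : ℝ} (ht : 0 < t)
    (htX : ENNReal.ofReal t < volume X) : decreasingRearrangement X h t ≠ ⊥ := by
  have hU : X = ⋃ n : ℕ, {x ∈ X | -(n : ℝ) < h x} := by
    ext x
    simp only [mem_iUnion, mem_ofPred_eq, exists_and_left]
    refine ⟨fun hx => ⟨hx, ?_⟩, fun hx => hx.1⟩
    obtain ⟨n, hn⟩ := exists_nat_gt (-h x)
    exact ⟨n, by linarith⟩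
  have hmono : Monotone fun n : ℕ => {x ∈ X | -(n : ℝ) < h x} := by
    intro m n hmn x hx
    have : (m : ℝ) ≤ n := by exact_mod_cast hmn
    exact ⟨hx.1, by linarith [hx.2]⟩
  have hlt := htX
  rw [hU, hmono.measure_iUnion, lt_iSup_iff] at hlt
  obtain ⟨n, hn⟩ := hlt
  exact ne_bot_of_gt ((coe_lt_decreasingRearrangement_iff ht.ne' htX.ne _).2 hn)

theorem decreasingRearrangement_ne_top (hX : MeasurableSet X) (hXfin : volume X ≠ ⊤)
    (hh : AEMeasurable h (volume.restrict X)) {t : ℝ} (ht : 0 < t)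
    (htX : ENNReal.ofReal t < volume X) : decreasingRearrangement X h t ≠ ⊤ := by
  have hanti : Antitone fun n : ℕ => {x | (n : ℝ) < h x} := by
    intro m n hmn x hx
    have : (m : ℝ) ≤ n := by exact_mod_cast hmn
    exact this.trans_lt hx
  have hempty : ⋂ n : ℕ, {x | (n : ℝ) < h x} = ∅ := by
    ext x
    simp only [mem_iInter, mem_ofPred_eq, mem_empty_iff_false, iff_false, not_forall, not_lt]
    exact exists_nat_ge (h x)
  have hlim := tendsto_measure_iInter_atTop (μ := volume.restrict X)
    (fun n : ℕ => nullMeasurableSet_lt aemeasurable_const hh) hanti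
    ⟨0, (Measure.restrict_apply' hX ▸
      (measure_mono inter_subset_right).trans_lt hXfin.lt_top).ne⟩
  rw [hempty, measure_empty] at hlim
  obtain ⟨n, hn⟩ := (hlim.eventually_lt_const (ENNReal.ofReal_pos.2 ht)).exists
  rw [Function.comp_apply, Measure.restrict_apply' hX] at hn
  intro htop
  have := (coe_lt_decreasingRearrangement_iff (h := h) ht.ne' htX.ne n).1
    (htop ▸ EReal.coe_lt_top _)
  refine (this.trans_le (measure_mono ?_)).not_gt hn
  exact fun x hx => ⟨hx.2, hx.1⟩

/-- For `0 < t < L` the rearrangement is finite, so `toReal` loses nothing; infinite values can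
occur only at the two end points, a null set. -/
theorem lt_toReal_decreasingRearrangement_iff (hX : MeasurableSet X)
    (hL : volume X = ENNReal.ofReal L) (hh : AEMeasurable h (volume.restrict X)) {t : ℝ}
    (ht : t ∈ Ioo 0 L) (s : ℝ) :
    s < (decreasingRearrangement X h t).toReal ↔
      ENNReal.ofReal t < volume {x ∈ X | s < h x} := by
  have htX : ENNReal.ofReal t < volume X := by
    rw [hL]; exact (ENNReal.ofReal_lt_ofReal_iff (ht.1.trans ht.2)).2 ht.2
  rw [← coe_lt_decreasingRearrangement_iff ht.1.ne' htX.ne,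
    ← EReal.coe_lt_coe_iff, EReal.coe_toReal
      (decreasingRearrangement_ne_top hX (by simp [hL]) hh ht.1 htX)
      (decreasingRearrangement_ne_bot ht.1 htX)]

theorem antitoneOn_toReal_decreasingRearrangement (hX : MeasurableSet X)
    (hL : volume X = ENNReal.ofReal L) (hh : AEMeasurable h (volume.restrict X)) :
    AntitoneOn (fun t => (decreasingRearrangement X h t).toReal) (Ioo 0 L) := by
  intro t ht t' ht' htt'
  refine le_of_forall_lt fun s hs => ?_
  rw [lt_toReal_decreasingRearrangement_iff hX hL hh ht'] at hs
  rw [lt_toReal_decreasingRearrangement_iff hX hL hh ht]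
  exact (ENNReal.ofReal_le_ofReal htt').trans_lt hs

theorem aemeasurable_toReal_decreasingRearrangement (hX : MeasurableSet X)
    (hL : volume X = ENNReal.ofReal L) (hh : AEMeasurable h (volume.restrict X)) :
    AEMeasurable (fun t => (decreasingRearrangement X h t).toReal)
      (volume.restrict (Ioo 0 L)) :=
  aemeasurable_restrict_of_antitoneOn measurableSet_Ioo
    (antitoneOn_toReal_decreasingRearrangement hX hL hh)

/-- A function and its decreasing rearrangement are equimeasurable. -/
theorem map_toReal_decreasingRearrangement (hX : MeasurableSet X)
    (hL : volume X = ENNReal.ofReal L) (hh : AEMeasurable h (volume.restrict X)) :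
    Measure.map (fun t => (decreasingRearrangement X h t).toReal) (volume.restrict (Ioo 0 L)) =
      Measure.map h (volume.restrict X) := by
  have hR := aemeasurable_toReal_decreasingRearrangement hX hL hh
  have : IsFiniteMeasure (volume.restrict X) := ⟨by simp [hL]⟩
  have hIoi : ∀ a : ℝ, Measure.map (fun t => (decreasingRearrangement X h t).toReal)
      (volume.restrict (Ioo 0 L)) (Ioi a) = Measure.map h (volume.restrict X) (Ioi a) := by
    intro a
    rw [Measure.map_apply_of_aemeasurable hR measurableSet_Ioi,
      Measure.map_apply_of_aemeasurable hh measurableSet_Ioi,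
      Measure.restrict_apply' measurableSet_Ioo, Measure.restrict_apply' hX]
    have hle : volume {x ∈ X | a < h x} ≤ ENNReal.ofReal L :=
      hL ▸ measure_mono fun x hx => hx.1
    have hne : volume {x ∈ X | a < h x} ≠ ⊤ := (hle.trans_lt ENNReal.ofReal_lt_top).ne
    -- Superlevel sets of the rearrangement are initial intervals whose length is the distribution
    -- function.
    have h1 : (fun t => (decreasingRearrangement X h t).toReal) ⁻¹' Ioi a ∩ Ioo 0 L =
        Ioo 0 (volume {x ∈ X | a < h x}).toReal := by
      ext t
      constructor
      · rintro ⟨hta, ht⟩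
        have := (lt_toReal_decreasingRearrangement_iff hX hL hh ht a).1 hta
        exact ⟨ht.1, (ENNReal.ofReal_lt_iff_lt_toReal ht.1.le hne).1 this⟩
      · rintro ⟨ht0, ht⟩
        have htL : t ∈ Ioo 0 L := by
          refine ⟨ht0, ?_⟩
          have h2 := ((ENNReal.ofReal_lt_iff_lt_toReal ht0.le hne).2 ht).trans_le hle
          exact (ENNReal.ofReal_lt_ofReal_iff_of_nonneg ht0.le).1 h2
        exact ⟨(lt_toReal_decreasingRearrangement_iff hX hL hh htL a).2
          ((ENNReal.ofReal_lt_iff_lt_toReal ht0.le hne).2 ht), htL⟩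
    rw [h1, Real.volume_Ioo, sub_zero, ENNReal.ofReal_toReal hne]
    congr 1
    ext x
    exact and_comm
  have huniv : Measure.map (fun t => (decreasingRearrangement X h t).toReal)
      (volume.restrict (Ioo 0 L)) univ = Measure.map h (volume.restrict X) univ := by
    rw [Measure.map_apply_of_aemeasurable hR .univ, Measure.map_apply_of_aemeasurable hh .univ]
    simp [hL]
  refine Measure.ext_of_Iic _ _ fun a => ?_
  rw [← compl_Ioi, measure_compl measurableSet_Ioi (measure_ne_top _ _),
    measure_compl measurableSet_Ioi (measure_ne_top _ _), huniv, hIoi]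

theorem integral_comp_toReal_decreasingRearrangement (hX : MeasurableSet X)
    (hL : volume X = ENNReal.ofReal L) (hh : AEMeasurable h (volume.restrict X)) {G : ℝ → ℝ}
    (hG : Measurable G) :
    ∫ t in Ioo 0 L, G (decreasingRearrangement X h t).toReal = ∫ x in X, G (h x) := by
  rw [← integral_map hh hG.aestronglyMeasurable, ← map_toReal_decreasingRearrangement hX hL hh,
    integral_map (aemeasurable_toReal_decreasingRearrangement hX hL hh) hG.aestronglyMeasurable]

theorem integrableOn_toReal_decreasingRearrangement (hX : MeasurableSet X)
    (hL : volume X = ENNReal.ofReal L) (hh : IntegrableOn h X) :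
    IntegrableOn (fun t => (decreasingRearrangement X h t).toReal) (Ioo 0 L) := by
  have h1 : Integrable id (Measure.map h (volume.restrict X)) :=
    (integrable_map_measure measurable_id.aestronglyMeasurable hh.aemeasurable).2 hh
  rw [← map_toReal_decreasingRearrangement hX hL hh.aemeasurable, integrable_map_measure
    measurable_id.aestronglyMeasurable
    (aemeasurable_toReal_decreasingRearrangement hX hL hh.aemeasurable)] at h1
  exact h1

/-- The bathtub principle. -/
theorem integral_mul_le_integral_decreasingRearrangement (hX : MeasurableSet X)
    (hL : volume X = ENNReal.ofReal L) (hh : IntegrableOn h X) {φ : ℝ → ℝ}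
    (hφm : AEStronglyMeasurable φ (volume.restrict X)) (hφ0 : ∀ x ∈ X, 0 ≤ φ x)
    (hφ1 : ∀ x ∈ X, φ x ≤ 1) {τ : ℝ} (hτ : τ ∈ Ioo 0 L) (hφ : ∫ x in X, φ x = τ) :
    ∫ x in X, h x * φ x ≤ ∫ t in Ioo 0 τ, (decreasingRearrangement X h t).toReal := by
  set R : ℝ → ℝ := fun t => (decreasingRearrangement X h t).toReal with hRdef
  have hR := integrableOn_toReal_decreasingRearrangement hX hL hh
  have hanti := antitoneOn_toReal_decreasingRearrangement hX hL hh.aemeasurable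
  have : IsFiniteMeasure (volume.restrict X) := ⟨by simp [hL]⟩
  -- The level `s` acts as a Lagrange multiplier: `(h - s)φ ≤ (h - s)⁺` pointwise, and `∫(h - s)⁺`
  -- is computed on the rearranged side, where the positive part lives on `(0, τ)`.
  set s := R τ with hs
  have hφi : IntegrableOn φ X := by
    refine Integrable.of_bound hφm 1 ?_
    filter_upwards [ae_restrict_mem hX] with x hx
    rw [Real.norm_eq_abs, abs_of_nonneg (hφ0 x hx)]
    exact hφ1 x hx
  have hhφ : IntegrableOn (fun x => h x * φ x) X := by
    refine Integrable.mul_bdd (c := 1) hh hφm ?_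
    filter_upwards [ae_restrict_mem hX] with x hx
    rw [Real.norm_eq_abs, abs_of_nonneg (hφ0 x hx)]
    exact hφ1 x hx
  have hpos : IntegrableOn (fun x => max (h x - s) 0) X := (hh.sub (integrable_const s)).pos_part
  have h1 : ∫ x in X, h x * φ x - s * φ x ≤ ∫ x in X, max (h x - s) 0 := by
    refine setIntegral_mono_on (hhφ.sub (hφi.const_mul s)) hpos hX fun x hx => ?_
    have e0 := hφ0 x hx
    have e1 := hφ1 x hx
    rcases le_total (h x - s) 0 with hle | hle
    · rw [max_eq_right hle]; nlinarith
    · rw [max_eq_left hle]; nlinarith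
  rw [integral_sub hhφ (hφi.const_mul s), integral_const_mul, hφ] at h1
  have h2 : ∫ x in X, max (h x - s) 0 = ∫ t in Ioo 0 L, max (R t - s) 0 :=
    (integral_comp_toReal_decreasingRearrangement hX hL hh.aemeasurable
      (G := fun r => max (r - s) 0) (by fun_prop)).symm
  have h3 : ∫ t in Ioo 0 L, max (R t - s) 0 = ∫ t in Ioo 0 τ, max (R t - s) 0 := by
    refine (setIntegral_eq_of_subset_of_forall_sdiff_eq_zero measurableSet_Ioo
      (Ioo_subset_Ioo_right hτ.2.le) fun t ht => ?_)
    have : τ ≤ t := by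
      by_contra! hlt
      exact ht.2 ⟨ht.1.1, hlt⟩
    exact max_eq_right (sub_nonpos.2 (hanti hτ ht.1 this))
  have h4 : ∫ t in Ioo 0 τ, max (R t - s) 0 = ∫ t in Ioo 0 τ, (R t - s) := by
    refine setIntegral_congr_fun measurableSet_Ioo fun t ht => ?_
    exact max_eq_left (sub_nonneg.2 (hanti ⟨ht.1, ht.2.trans hτ.2⟩ hτ ht.2.le))
  have h5 : ∫ t in Ioo 0 τ, (R t - s) = (∫ t in Ioo 0 τ, R t) - s * τ := by
    rw [integral_sub (hR.mono_set (Ioo_subset_Ioo_right hτ.2.le)) (by simp)]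
    simp [hτ.1.le, mul_comm, hRdef]
  linarith

end Rearrangement

/-! ### Oscillation and Cauchy–Schwarz inequalities on an interval. -/

/-- A function with equal end values crosses the gap between any two of its values twice. -/
theorem two_mul_sub_le_integral_abs_deriv {A B p q : ℝ} {G g : ℝ → ℝ}
    (hG : ContinuousOn G (Icc A B)) (hg : ContinuousOn g (Icc A B))
    (hderiv : ∀ x ∈ Ioo A B, HasDerivAt G (g x) x) (hAB : G A = G B)
    (hp : p ∈ Icc A B) (hq : q ∈ Icc A B) :
    2 * (G p - G q) ≤ ∫ x in A..B, |g x| := by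
  have key : ∀ a b, A ≤ a → a ≤ b → b ≤ B → |G b - G a| ≤ ∫ x in a..b, |g x| := by
    intro a b ha hab hb
    have hsub : Icc a b ⊆ Icc A B := Icc_subset_Icc ha hb
    rw [← intervalIntegral.integral_eq_sub_of_hasDerivAt_of_le hab (hG.mono hsub)
      (fun x hx => hderiv x ⟨ha.trans_lt hx.1, hx.2.trans_le hb⟩)
      ((hg.mono hsub).intervalIntegrable_of_Icc hab)]
    exact intervalIntegral.abs_integral_le_integral_abs hab
  have hint : ∀ a b, A ≤ a → a ≤ b → b ≤ B →
      IntervalIntegrable (fun x => |g x|) volume a b := fun a b ha hab hb =>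
    (hg.abs.mono (Icc_subset_Icc ha hb)).intervalIntegrable_of_Icc hab
  -- Since `G A = G B`, the two outer increments together cancel the inner one, so the gap is
  -- counted twice.
  have split : ∀ a b, A ≤ a → a ≤ b → b ≤ B →
      |G a - G A| + |G b - G a| + |G B - G b| ≤ ∫ x in A..B, |g x| := by
    intro a b ha hab hb
    rw [← intervalIntegral.integral_add_adjacent_intervals (hint A a le_rfl ha (hab.trans hb))
      (hint a B ha (hab.trans hb) le_rfl),
      ← intervalIntegral.integral_add_adjacent_intervals (hint a b ha hab hb)
      (hint b B (ha.trans hab) hb le_rfl)]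
    linarith [key A a le_rfl ha (hab.trans hb), key a b ha hab hb,
      key b B (ha.trans hab) hb le_rfl]
  rcases le_total p q with hpq | hpq
  · have := split p q hp.1 hpq hq.2
    linarith [le_abs_self (G p - G A), neg_le_abs (G q - G p), le_abs_self (G B - G q)]
  · have := split q p hq.1 hpq hp.2
    linarith [neg_le_abs (G q - G A), le_abs_self (G p - G q), neg_le_abs (G B - G p)]

/-- A weighted Cauchy–Schwarz inequality. -/
theorem sq_integral_mul_abs_le {A B : ℝ} (hAB : A ≤ B) {p g : ℝ → ℝ}
    (hp : ContinuousOn p (Icc A B)) (hg : ContinuousOn g (Icc A B)) (hp0 : ∀ x, 0 ≤ p x) :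
    (∫ x in A..B, p x * |g x|) ^ 2 ≤ (∫ x in A..B, p x) * ∫ x in A..B, p x * g x ^ 2 := by
  set T := ∫ x in A..B, p x * |g x|
  set P := ∫ x in A..B, p x
  set Q := ∫ x in A..B, p x * g x ^ 2
  have iP := hp.intervalIntegrable_of_Icc (μ := volume) hAB
  have iT : IntervalIntegrable (fun x => p x * |g x|) volume A B :=
    (hp.mul hg.abs).intervalIntegrable_of_Icc hAB
  have iQ : IntervalIntegrable (fun x => p x * g x ^ 2) volume A B :=
    (hp.mul (hg.pow 2)).intervalIntegrable_of_Icc hAB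
  -- Integrating `p (|g| - l)² ≥ 0` gives a quadratic in `l` without sign change; its discriminant
  -- is the claim.
  have key : ∀ l : ℝ, 0 ≤ P * (l * l) + (-2 * T) * l + Q := by
    intro l
    have h0 : 0 ≤ ∫ x in A..B, p x * (|g x| - l) ^ 2 :=
      intervalIntegral.integral_nonneg hAB fun x _ => mul_nonneg (hp0 x) (sq_nonneg _)
    have h1 : ∫ x in A..B, p x * (|g x| - l) ^ 2 =
        ∫ x in A..B, ((l * l) * p x + (-2 * l) * (p x * |g x|) + p x * g x ^ 2) := by
      refine intervalIntegral.integral_congr fun x _ => ?_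
      rw [← sq_abs (g x)]
      ring
    rw [h1, intervalIntegral.integral_add ((iP.const_mul _).add (iT.const_mul _)) iQ,
      intervalIntegral.integral_add (iP.const_mul _) (iT.const_mul _),
      intervalIntegral.integral_const_mul, intervalIntegral.integral_const_mul] at h0
    linarith
  have := discrim_le_zero key
  rw [discrim] at this
  linarith

/-! ### Weak formulation, periodicity and the energy estimate. -/

namespace IsZeroMeanNeumannSolution

variable {f u : ℝ → ℝ}

theorem hasDerivAt (hu : IsZeroMeanNeumannSolution f u) {x : ℝ}
    (hx : x ∈ Ioo (-Real.pi) Real.pi) :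
    HasDerivAt u (derivWithin u (Icc (-Real.pi) Real.pi) x) x :=
  ((hu.contDiffOn.differentiableOn one_ne_zero x
    (Ioo_subset_Icc_self hx)).hasDerivWithinAt).hasDerivAt (Icc_mem_nhds hx.1 hx.2)

theorem continuousOn_derivWithin (hu : IsZeroMeanNeumannSolution f u) :
    ContinuousOn (derivWithin u (Icc (-Real.pi) Real.pi)) (Icc (-Real.pi) Real.pi) := by
  have := hu.absolutelyContinuous_deriv.continuousOn
  rwa [uIcc_of_le (by linarith [Real.pi_pos])] at this

theorem ae_deriv_derivWithin (hu : IsZeroMeanNeumannSolution f u) {a b : ℝ}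
    (ha : -Real.pi ≤ a) (hab : a ≤ b) (hb : b ≤ Real.pi) :
    ∀ᵐ x, x ∈ uIoc a b → deriv (derivWithin u (Icc (-Real.pi) Real.pi)) x = -f x := by
  have h1 := (ae_restrict_iff' measurableSet_Ioo).1 hu.equation
  filter_upwards [h1, Measure.ae_ne volume Real.pi] with x hx hne hxab
  rw [uIoc_of_le hab] at hxab
  exact (hx ⟨ha.trans_lt hxab.1, lt_of_le_of_ne (hxab.2.trans hb) hne⟩).deriv

/-- Integration by parts; the Neumann conditions remove the boundary terms, so `φ` is unrestricted
at the end points. -/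
theorem integral_mul_eq (hu : IsZeroMeanNeumannSolution f u) {φ : ℝ → ℝ}
    (hφ : AbsolutelyContinuousOnInterval φ (-Real.pi) Real.pi) :
    ∫ x in (-Real.pi)..Real.pi, φ x * f x =
      ∫ x in (-Real.pi)..Real.pi, deriv φ x * derivWithin u (Icc (-Real.pi) Real.pi) x := by
  have h := hφ.integral_mul_deriv_eq_deriv_mul hu.absolutelyContinuous_deriv
  rw [hu.deriv_left, hu.deriv_right] at h
  have h1 : ∫ x in (-Real.pi)..Real.pi,
      φ x * deriv (derivWithin u (Icc (-Real.pi) Real.pi)) x =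
      ∫ x in (-Real.pi)..Real.pi, -(φ x * f x) := by
    refine intervalIntegral.integral_congr_ae ?_
    filter_upwards [hu.ae_deriv_derivWithin le_rfl (by linarith [Real.pi_pos]) le_rfl]
      with x hx hx'
    rw [hx hx']
    ring
  rw [h1, intervalIntegral.integral_neg] at h
  linarith

theorem integral_eq_sub (hu : IsZeroMeanNeumannSolution f u) {a b : ℝ}
    (ha : -Real.pi ≤ a) (hab : a ≤ b) (hb : b ≤ Real.pi) :
    ∫ x in a..b, f x = derivWithin u (Icc (-Real.pi) Real.pi) a -
      derivWithin u (Icc (-Real.pi) Real.pi) b := by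
  have hsub : uIcc a b ⊆ uIcc (-Real.pi) Real.pi := by
    rw [uIcc_of_le hab, uIcc_of_le (by linarith)]
    exact Icc_subset_Icc ha hb
  have h := (hu.absolutelyContinuous_deriv.mono hsub).integral_deriv_eq_sub
  rw [intervalIntegral.integral_congr_ae (hu.ae_deriv_derivWithin ha hab hb),
    intervalIntegral.integral_neg] at h
  linarith

/-- A vanishing first moment of the data makes the solution periodic. -/
theorem apply_pi_eq (hu : IsZeroMeanNeumannSolution f u)
    (hf1 : ∫ x in (-Real.pi)..Real.pi, x * f x = 0) : u (-Real.pi) = u Real.pi := by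
  have hpi : -Real.pi ≤ Real.pi := by linarith [Real.pi_pos]
  have h1 := hu.integral_mul_eq (φ := fun x => x) contDiffOn_id.absolutelyContinuousOnInterval
  simp only [hf1, deriv_id'', one_mul] at h1
  rw [intervalIntegral.integral_eq_sub_of_hasDerivAt_of_le hpi hu.contDiffOn.continuousOn
    (fun x hx => hu.hasDerivAt hx)
    (hu.continuousOn_derivWithin.intervalIntegrable_of_Icc hpi)] at h1
  linarith

/-- Energy estimate for a nonlinear truncation of a periodic solution. -/
theorem four_mul_sq_sub_le (hu : IsZeroMeanNeumannSolution f u)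
    (hper : u (-Real.pi) = u Real.pi) {Φ ψ : ℝ → ℝ} (hψ : Continuous ψ) (hψ0 : ∀ r, 0 ≤ ψ r)
    (hΦ : ∀ r, HasDerivAt Φ (ψ r) r) {p q : ℝ} (hp : p ∈ Icc (-Real.pi) Real.pi)
    (hq : q ∈ Icc (-Real.pi) Real.pi) (hqp : Φ (u q) ≤ Φ (u p)) :
    4 * (Φ (u p) - Φ (u q)) ^ 2 ≤ (∫ x in (-Real.pi)..Real.pi, ψ (u x)) *
      ∫ x in (-Real.pi)..Real.pi, Φ (u x) * f x := by
  set du := derivWithin u (Icc (-Real.pi) Real.pi) with hdu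
  have hpi : -Real.pi ≤ Real.pi := by linarith [Real.pi_pos]
  have hΦC : ContDiff ℝ 1 Φ := by
    rw [contDiff_one_iff_deriv]
    refine ⟨fun r => (hΦ r).differentiableAt, ?_⟩
    rwa [show deriv Φ = ψ from funext fun r => (hΦ r).deriv]
  have huC := hu.contDiffOn.continuousOn
  have hψu : ContinuousOn (fun x => ψ (u x)) (Icc (-Real.pi) Real.pi) := hψ.comp_continuousOn huC
  have hder : ∀ x ∈ Ioo (-Real.pi) Real.pi,
      HasDerivAt (fun x => Φ (u x)) (ψ (u x) * du x) x := fun x hx =>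
    (hΦ (u x)).comp x (hu.hasDerivAt hx)
  have h1 := two_mul_sub_le_integral_abs_deriv (hΦC.continuous.comp_continuousOn huC)
    (hψu.mul hu.continuousOn_derivWithin) hder (by simp [hper]) hp hq
  have h2 := sq_integral_mul_abs_le hpi hψu hu.continuousOn_derivWithin fun x => hψ0 _
  have h3 : ∫ x in (-Real.pi)..Real.pi, Φ (u x) * f x =
      ∫ x in (-Real.pi)..Real.pi, ψ (u x) * du x ^ 2 := by
    rw [hu.integral_mul_eq (φ := fun x => Φ (u x))]
    · refine intervalIntegral.integral_congr_Ioo_of_le hpi fun x hx => ?_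
      simp only [(hder x hx).deriv, ← hdu]
      ring
    · refine ContDiffOn.absolutelyContinuousOnInterval ?_
      rw [uIcc_of_le hpi]
      exact hΦC.comp_contDiffOn hu.contDiffOn
  rw [h3]
  refine le_trans ?_ h2
  have h4 : ∫ x in (-Real.pi)..Real.pi, |ψ (u x) * du x| =
      ∫ x in (-Real.pi)..Real.pi, ψ (u x) * |du x| :=
    intervalIntegral.integral_congr fun x _ => by simp [abs_mul, abs_of_nonneg (hψ0 (u x))]
  simp only [Pi.mul_apply] at h1
  rw [h4] at h1
  simp only [Function.comp_apply] at h1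
  nlinarith [sub_nonneg.2 hqp]

end IsZeroMeanNeumannSolution

/-! ### The differential inequality for the rearranged solution. -/

/-- `ψ` is a trapezoid with ramps of width `δ`. It vanishes at `a` and `b` themselves, so plateaus
of `u` at these levels add nothing to `∫ψ(u)`. -/
theorem exists_truncation {a b δ : ℝ} (hδ : 0 < δ) (hab : b + 2 * δ ≤ a) :
    ∃ ψ Φ : ℝ → ℝ, Continuous ψ ∧ (∀ r, 0 ≤ ψ r) ∧ (∀ r, ψ r ≤ 1) ∧
      (∀ r, r ≤ b → ψ r = 0) ∧ (∀ r, a ≤ r → ψ r = 0) ∧ (∀ r, HasDerivAt Φ (ψ r) r) ∧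
      Monotone Φ ∧ (∀ r, r ≤ b → Φ r = 0) ∧ (∀ r, a ≤ r → Φ r = Φ a) ∧
      a - b - 2 * δ ≤ Φ a := by
  set ψ : ℝ → ℝ := fun r => max 0 (min 1 (min ((r - b) / δ) ((a - r) / δ))) with hψ
  have hc : Continuous ψ := by fun_prop
  have h0 : ∀ r, 0 ≤ ψ r := fun r => le_max_left _ _
  have h1 : ∀ r, ψ r ≤ 1 := fun r => max_le zero_le_one (min_le_left _ _)
  have hb : ∀ r, r ≤ b → ψ r = 0 := fun r hr => max_eq_left <|
    (min_le_right _ _).trans <| (min_le_left _ _).trans <|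
      div_nonpos_of_nonpos_of_nonneg (by linarith) hδ.le
  have ha : ∀ r, a ≤ r → ψ r = 0 := fun r hr => max_eq_left <|
    (min_le_right _ _).trans <| (min_le_right _ _).trans <|
      div_nonpos_of_nonpos_of_nonneg (by linarith) hδ.le
  have hmid : ∀ r ∈ Icc (b + δ) (a - δ), ψ r = 1 := by
    intro r hr
    have e1 : 1 ≤ (r - b) / δ := (one_le_div hδ).2 (by linarith [hr.1])
    have e2 : 1 ≤ (a - r) / δ := (one_le_div hδ).2 (by linarith [hr.2])
    simp only [hψ]
    rw [min_eq_left (le_min e1 e2), max_eq_right zero_le_one]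
  have hd : ∀ r, HasDerivAt (fun r => ∫ s in b..r, ψ s) (ψ r) r := fun r =>
    intervalIntegral.integral_hasDerivAt_right (hc.intervalIntegrable _ _)
      (hc.stronglyMeasurableAtFilter _ _) hc.continuousAt
  have hint : ∀ x y, IntervalIntegrable ψ volume x y := fun x y => hc.intervalIntegrable x y
  refine ⟨ψ, fun r => ∫ s in b..r, ψ s, hc, h0, h1, hb, ha, hd,
    monotone_of_hasDerivAt_nonneg hd h0, fun r hr => ?_, fun r hr => ?_, ?_⟩
  · dsimp only
    rw [intervalIntegral.integral_congr (g := fun _ => 0), intervalIntegral.integral_zero]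
    intro s hs
    rw [uIcc_of_ge hr] at hs
    exact hb s hs.2
  · dsimp only
    rw [← intervalIntegral.integral_add_adjacent_intervals (hint b a) (hint a r),
      intervalIntegral.integral_congr (a := a) (b := r) (g := fun _ => 0),
      intervalIntegral.integral_zero, add_zero]
    intro s hs
    rw [uIcc_of_le hr] at hs
    exact ha s hs.1
  · dsimp only
    rw [← intervalIntegral.integral_add_adjacent_intervals (hint b (b + δ)) (hint (b + δ) a),
      ← intervalIntegral.integral_add_adjacent_intervals (hint (b + δ) (a - δ)) (hint (a - δ) a)]
    have e1 : 0 ≤ ∫ s in b..(b + δ), ψ s :=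
      intervalIntegral.integral_nonneg (by linarith) fun x _ => h0 x
    have e2 : 0 ≤ ∫ s in (a - δ)..a, ψ s :=
      intervalIntegral.integral_nonneg (by linarith) fun x _ => h0 x
    have e3 : ∫ s in (b + δ)..(a - δ), ψ s = ∫ s in (b + δ)..(a - δ), (1 : ℝ) := by
      refine intervalIntegral.integral_congr fun s hs => ?_
      rw [uIcc_of_le (by linarith)] at hs
      exact hmid s hs
    rw [intervalIntegral.integral_const, smul_eq_mul, mul_one] at e3
    linarith

theorem volume_Icc_neg_pi_pi :
    volume (Icc (-Real.pi) Real.pi) = ENNReal.ofReal (2 * Real.pi) := by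
  rw [Real.volume_Icc]; ring_nf

theorem integral_eq_setIntegral_Icc {a b : ℝ} (hab : a ≤ b) (g : ℝ → ℝ) :
    ∫ x in a..b, g x = ∫ x in Icc a b, g x := by
  rw [intervalIntegral.integral_of_le hab, integral_Icc_eq_integral_Ioc]

/-- The bathtub principle with the constant weight `τ / L`. -/
theorem integral_decreasingRearrangement_nonneg {X : Set ℝ} {h : ℝ → ℝ} {L τ : ℝ}
    (hX : MeasurableSet X) (hL : volume X = ENNReal.ofReal L) (hh : IntegrableOn h X)
    (hh0 : ∫ x in X, h x = 0) (hτ : τ ∈ Ioo 0 L) :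
    0 ≤ ∫ t in Ioo 0 τ, (decreasingRearrangement X h t).toReal := by
  have hL0 : 0 < L := hτ.1.trans hτ.2
  have := integral_mul_le_integral_decreasingRearrangement hX hL hh (φ := fun _ => τ / L)
    aestronglyMeasurable_const (fun _ _ => (div_pos hτ.1 hL0).le)
    (fun _ _ => (div_le_one hL0).2 hτ.2.le) hτ (by
      simp [Measure.real, hL, hL0.le, mul_div_cancel₀ _ hL0.ne'])
  rwa [integral_mul_const, hh0, zero_mul] at this

theorem IsZeroMeanNeumannSolution.four_mul_decreasingRearrangement_sub_le {f u : ℝ → ℝ}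
    (hu : IsZeroMeanNeumannSolution f u) (hf : IntegrableOn f (Icc (-Real.pi) Real.pi))
    (hf0 : ∫ x in (-Real.pi)..Real.pi, f x = 0)
    (hper : u (-Real.pi) = u Real.pi) {t t' M : ℝ} (ht : 0 < t) (htt' : t < t')
    (ht' : t' < 2 * Real.pi)
    (hM : ∀ τ ∈ Icc t t',
      ∫ s in Ioo 0 τ, (decreasingRearrangement (Icc (-Real.pi) Real.pi) f s).toReal ≤ M) :
    4 * ((decreasingRearrangement (Icc (-Real.pi) Real.pi) u t).toReal -
      (decreasingRearrangement (Icc (-Real.pi) Real.pi) u t').toReal) ≤ (t' - t) * M := by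
  have hpi : -Real.pi ≤ Real.pi := by linarith [Real.pi_pos]
  have hL := volume_Icc_neg_pi_pi
  set X := Icc (-Real.pi) Real.pi with hXdef
  set L := 2 * Real.pi with hLdef
  have hX : MeasurableSet X := measurableSet_Icc
  set R : ℝ → ℝ := fun t => (decreasingRearrangement X u t).toReal with hR
  have hfX : ∫ x in X, f x = 0 := by rw [← integral_eq_setIntegral_Icc hpi, hf0]
  have htL : t ∈ Ioo 0 L := ⟨ht, htt'.trans ht'⟩
  have htL' : t' ∈ Ioo 0 L := ⟨ht.trans htt', ht'⟩
  have hM0 : 0 ≤ M := (integral_decreasingRearrangement_nonneg hX hL hf hfX htL).trans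
    (hM t ⟨le_rfl, htt'.le⟩)
  have huC : ContinuousOn u X := hu.contDiffOn.continuousOn
  have hum : AEMeasurable u (volume.restrict X) := huC.aemeasurable hX
  have hanti : AntitoneOn R (Ioo 0 L) := antitoneOn_toReal_decreasingRearrangement hX hL hum
  have hRm : AEMeasurable R (volume.restrict (Ioo 0 L)) :=
    aemeasurable_toReal_decreasingRearrangement hX hL hum
  change 4 * (R t - R t') ≤ (t' - t) * M
  have hRM : 0 ≤ (t' - t) * M := mul_nonneg (by linarith) hM0
  rcases le_or_gt (R t) (R t') with hle | hlt
  · linarith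
  have hXne : X.Nonempty := nonempty_Icc.2 hpi
  obtain ⟨p, hp, hpmax⟩ := isCompact_Icc.exists_isMaxOn hXne huC
  obtain ⟨q, hq, hqmin⟩ := isCompact_Icc.exists_isMinOn hXne huC
  have hpa : R t ≤ u p := by
    by_contra! hlt
    have := (lt_toReal_decreasingRearrangement_iff hX hL hum htL _).1 hlt
    rw [show {x ∈ X | u p < u x} = ∅ from eq_empty_of_forall_notMem fun x hx =>
      (hpmax hx.1).not_gt hx.2, measure_empty] at this
    exact not_lt_zero this
  have hqb : u q ≤ R t' := by
    by_contra! hlt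
    refine lt_irrefl (R t') ((lt_toReal_decreasingRearrangement_iff hX hL hum htL' _).2 ?_)
    rw [show {x ∈ X | R t' < u x} = X from sep_eq_self_iff_mem_true.2 fun x hx =>
      hlt.trans_le (hqmin hx), hL]
    exact (ENNReal.ofReal_lt_ofReal_iff (ht.trans htL.2)).2 ht'
  refine le_of_forall_pos_le_add fun ε hε => ?_
  -- `4δ` keeps the truncation height positive; the height loses at most `2δ`, which the factor `4`
  -- turns into `8δ ≤ ε`.
  obtain ⟨δ, hδ, hδε, hδab⟩ : ∃ δ, 0 < δ ∧ 8 * δ ≤ ε ∧ 4 * δ ≤ R t - R t' := by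
    refine ⟨min (ε / 8) ((R t - R t') / 4), lt_min (by linarith) (by linarith), ?_, ?_⟩
    · linarith [min_le_left (ε / 8) ((R t - R t') / 4)]
    · linarith [min_le_right (ε / 8) ((R t - R t') / 4)]
  obtain ⟨ψ, Φ, hψc, hψ0, hψ1, hψb, hψa, hΦ, hΦmono, hΦb, hΦa, hH⟩ :=
    exists_truncation (a := R t) (b := R t') hδ (by linarith)
  set H := Φ (R t) with hHdef
  have hHpos : 0 < H := by linarith
  have hΦc : Continuous Φ := continuous_iff_continuousAt.2 fun r => (hΦ r).continuousAt
  have hΦ0 : ∀ r, 0 ≤ Φ r := fun r => by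
    rcases le_total r (R t') with h | h
    · rw [hΦb r h]
    · exact (hΦb _ le_rfl).symm.le.trans (hΦmono h)
  have hΦH : ∀ r, Φ r ≤ H := fun r => by
    rcases le_total (R t) r with h | h
    · rw [hΦa r h]
    · exact hΦmono h
  have hRΦ : ∀ G : ℝ → ℝ, Continuous G → (∀ r, 0 ≤ G r) → (∀ r, G r ≤ 1) →
      IntegrableOn (fun s => G (R s)) (Ioo 0 L) := fun G hG h0 h1 =>
    Integrable.of_bound (hG.measurable.comp_aemeasurable hRm).aestronglyMeasurable 1
      (Filter.Eventually.of_forall fun s => by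
        rw [Real.norm_eq_abs, abs_of_nonneg (h0 _)]; exact h1 _)
  -- the weight `ψ ∘ u` has integral at most `t' - t`
  have hP : ∫ x in (-Real.pi)..Real.pi, ψ (u x) ≤ t' - t := by
    have hsub : Icc t t' ⊆ Ioo 0 L := fun s hs =>
      ⟨ht.trans_le hs.1, hs.2.trans_lt ht'⟩
    have e1 : ∫ s in Ioo 0 L, ψ (R s) = ∫ s in Icc t t', ψ (R s) := by
      refine setIntegral_eq_of_subset_of_forall_sdiff_eq_zero measurableSet_Ioo hsub fun s hs => ?_
      rcases lt_or_ge s t with h | h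
      · exact hψa _ (hanti hs.1 htL h.le)
      · refine hψb _ (hanti htL' hs.1 ?_)
        by_contra! hst
        exact hs.2 ⟨h, hst.le⟩
    rw [integral_eq_setIntegral_Icc hpi,
      ← integral_comp_toReal_decreasingRearrangement hX hL hum hψc.measurable]
    change ∫ s in Ioo 0 L, ψ (R s) ≤ _
    rw [e1]
    calc ∫ s in Icc t t', ψ (R s) ≤ ∫ s in Icc t t', (1 : ℝ) :=
          setIntegral_mono ((hRΦ ψ hψc hψ0 hψ1).mono_set hsub) (by simp) fun s => hψ1 _
      _ = t' - t := by simp [htt'.le]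
  have hdiv0 : ∀ r, 0 ≤ Φ r / H := fun r => div_nonneg (hΦ0 r) hHpos.le
  have hdiv1 : ∀ r, Φ r / H ≤ 1 := fun r => (div_le_one hHpos).2 (hΦH r)
  -- After rearrangement the weight `Φ/H` is `1` on `(0, t)` and `0` beyond `t'`, so its mass is an
  -- admissible `τ` for `hM`.
  have hτ : ∫ x in X, Φ (u x) / H ∈ Icc t t' := by
    rw [← integral_comp_toReal_decreasingRearrangement hX hL hum
      (G := fun r => Φ r / H) (hΦc.div_const H).measurable]
    change ∫ s in Ioo 0 L, Φ (R s) / H ∈ Icc t t'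
    have hi := hRΦ (fun r => Φ r / H) (hΦc.div_const H) hdiv0 hdiv1
    constructor
    · calc t = ∫ s in Ioo 0 t, (1 : ℝ) := by simp [ht.le]
        _ = ∫ s in Ioo 0 t, Φ (R s) / H := by
          refine setIntegral_congr_fun measurableSet_Ioo fun s hs => ?_
          rw [hΦa _ (hanti ⟨hs.1, hs.2.trans htL.2⟩ htL hs.2.le), div_self hHpos.ne']
        _ ≤ ∫ s in Ioo 0 L, Φ (R s) / H :=
          setIntegral_mono_set hi (Filter.Eventually.of_forall fun s => hdiv0 _)
            (Ioo_subset_Ioo_right htL.2.le).eventuallyLE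
    · calc ∫ s in Ioo 0 L, Φ (R s) / H = ∫ s in Ioo 0 t', Φ (R s) / H := by
            refine setIntegral_eq_of_subset_of_forall_sdiff_eq_zero measurableSet_Ioo
              (Ioo_subset_Ioo_right ht'.le) fun s hs => ?_
            rw [hΦb _ (hanti htL' hs.1 ?_), zero_div]
            by_contra! hst
            exact hs.2 ⟨hs.1.1, hst⟩
        _ ≤ ∫ s in Ioo 0 t', (1 : ℝ) :=
          setIntegral_mono (hi.mono_set (Ioo_subset_Ioo_right ht'.le)) (by simp) fun s => hdiv1 _
        _ = t' := by simp [htL'.1.le]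
  have hQ : ∫ x in (-Real.pi)..Real.pi, Φ (u x) * f x ≤ H * M := by
    have hb := integral_mul_le_integral_decreasingRearrangement hX hL hf
      (φ := fun x => Φ (u x) / H)
      (((hΦc.div_const H).comp_continuousOn huC).aestronglyMeasurable hX)
      (fun x _ => hdiv0 _) (fun x _ => hdiv1 _)
      ⟨ht.trans_le hτ.1, hτ.2.trans_lt ht'⟩ rfl
    have hb2 := hb.trans (hM _ hτ)
    rw [integral_eq_setIntegral_Icc hpi]
    calc ∫ x in X, Φ (u x) * f x = H * ∫ x in X, f x * (Φ (u x) / H) := by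
          rw [← integral_const_mul]
          refine integral_congr_ae (Filter.Eventually.of_forall fun x => ?_)
          field_simp
      _ ≤ H * M := mul_le_mul_of_nonneg_left hb2 hHpos.le
  have hE := hu.four_mul_sq_sub_le hper hψc hψ0 hΦ hp hq
    (by rw [hΦb _ hqb]; exact hΦ0 _)
  rw [hΦa _ hpa, hΦb _ hqb, sub_zero] at hE
  have hP0 : 0 ≤ ∫ x in (-Real.pi)..Real.pi, ψ (u x) :=
    intervalIntegral.integral_nonneg hpi fun x _ => hψ0 _
  have hfin : H * (4 * H) ≤ H * ((t' - t) * M) := by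
    calc H * (4 * H) = 4 * H ^ 2 := by ring
      _ ≤ _ := hE
      _ ≤ (∫ x in (-Real.pi)..Real.pi, ψ (u x)) * (H * M) := mul_le_mul_of_nonneg_left hQ hP0
      _ ≤ (t' - t) * (H * M) := mul_le_mul_of_nonneg_right hP (mul_nonneg hHpos.le hM0)
      _ = H * ((t' - t) * M) := by ring
  have := le_of_mul_le_mul_left hfin hHpos
  linarith

/-! ### Monotonicity from local estimates, and integrals of monotone functions. -/

theorem integral_Ioo_eq_intervalIntegral {a b : ℝ} (hab : a ≤ b) (g : ℝ → ℝ) :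
    ∫ x in Ioo a b, g x = ∫ x in a..b, g x := by
  rw [intervalIntegral.integral_of_le hab, integral_Ioc_eq_integral_Ioo]

/-- A function that decreases at most at an arbitrarily small rate on short intervals is
monotone. -/
theorem monotoneOn_of_forall_sub_le {a b : ℝ} {k : ℝ → ℝ}
    (h : ∀ ε > 0, ∃ δ > 0, ∀ s ∈ Ioo a b, ∀ t ∈ Ioo a b, s < t → t - s < δ →
      k s - k t ≤ ε * (t - s)) : MonotoneOn k (Ioo a b) := by
  intro s hs t ht hst
  rcases hst.eq_or_lt with rfl | hst
  · exact le_rfl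
  refine le_of_forall_pos_le_add fun η hη => ?_
  obtain ⟨δ, hδ, hk⟩ := h (η / (t - s)) (div_pos hη (sub_pos.2 hst))
  set ε := η / (t - s)
  -- Telescoping: one step of length `d = (y - x)/(n + 2) < δ` is split off, and the remainder is
  -- shorter than `(n + 1)δ`.
  have key : ∀ n : ℕ, ∀ x ∈ Ioo a b, ∀ y ∈ Ioo a b, x < y → y - x < (n + 1) * δ →
      k x - k y ≤ ε * (y - x) := by
    intro n
    induction n with
    | zero =>
      intro x hx y hy hxy hlt
      exact hk x hx y hy hxy (by simpa using hlt)
    | succ n ih =>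
      intro x hx y hy hxy hlt
      push_cast at hlt
      have hn : (0 : ℝ) < n + 2 := by positivity
      set d := (y - x) / (n + 2) with hd
      have hd0 : 0 < d := div_pos (by linarith) hn
      have hdy : (n + 2) * d = y - x := mul_div_cancel₀ _ hn.ne'
      have hn0 : (0 : ℝ) ≤ n := n.cast_nonneg
      have hdδ : d < δ := by
        rw [hd, div_lt_iff₀ hn]
        linarith
      have hz : x + d < y := by nlinarith
      have hzm : x + d ∈ Ioo a b := ⟨by linarith [hx.1], hz.trans hy.2⟩
      have e1 := hk x hx (x + d) hzm (by linarith) (by linarith)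
      have e2 := ih (x + d) hzm y hy hz (by nlinarith)
      linarith
  obtain ⟨n, hn⟩ := exists_nat_gt ((t - s) / δ)
  have e := key n s hs t ht hst (by
    rw [div_lt_iff₀ hδ] at hn
    linarith)
  rw [div_mul_cancel₀ _ (sub_pos.2 hst).ne'] at e
  linarith

/-- Comparison with the constant `g t` on both sides of `t`: if `g t ≤ 0` the left integral is
nonpositive directly, otherwise the right one is nonnegative and the zero total decides. -/
theorem MonotoneOn.integral_nonpos_of_integral_eq_zero {L t : ℝ} {g : ℝ → ℝ}
    (hg : MonotoneOn g (Ioo 0 L)) (hi : IntervalIntegrable g volume 0 L)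
    (h0 : ∫ s in (0)..L, g s = 0) (ht : t ∈ Ioo 0 L) : ∫ s in (0)..t, g s ≤ 0 := by
  have hsub1 : uIcc 0 t ⊆ uIcc 0 L := by
    rw [uIcc_of_le ht.1.le, uIcc_of_le (ht.1.trans ht.2).le]
    exact Icc_subset_Icc_right ht.2.le
  have hsub2 : uIcc t L ⊆ uIcc 0 L := by
    rw [uIcc_of_le ht.2.le, uIcc_of_le (ht.1.trans ht.2).le]
    exact Icc_subset_Icc_left ht.1.le
  have i1 := hi.mono_set hsub1
  have i2 := hi.mono_set hsub2
  have e1 : ∫ s in (0)..t, g s ≤ ∫ _ in (0)..t, g t :=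
    intervalIntegral.integral_mono_on_of_le_Ioo ht.1.le i1 (by simp) fun s hs =>
      hg ⟨hs.1, hs.2.trans ht.2⟩ ht hs.2.le
  have e2 : ∫ _ in t..L, g t ≤ ∫ s in t..L, g s :=
    intervalIntegral.integral_mono_on_of_le_Ioo ht.2.le (by simp) i2 fun s hs =>
      hg ht ⟨ht.1.trans hs.1, hs.2⟩ hs.1.le
  rw [← intervalIntegral.integral_add_adjacent_intervals i1 i2] at h0
  simp only [intervalIntegral.integral_const, smul_eq_mul, sub_zero] at e1 e2
  rcases le_total (g t) 0 with h | h
  · nlinarith [ht.1]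
  · nlinarith [ht.2]

theorem ContinuousOn.integral_half_add_half {v : ℝ → ℝ} {b t : ℝ}
    (hv : ContinuousOn v (Icc (-b) b)) (ht : 0 ≤ t) (htb : t ≤ 2 * b) :
    IntervalIntegrable (fun s => (v (s / 2) + v (-(s / 2))) / 2) volume 0 t ∧
      ∫ s in (0)..t, (v (s / 2) + v (-(s / 2))) / 2 = ∫ x in (-(t / 2))..(t / 2), v x := by
  have c1 : ContinuousOn (fun s => v (s / 2)) (Icc 0 t) := by
    refine hv.comp (by fun_prop) fun s hs => ?_
    constructor <;> linarith [hs.1, hs.2]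
  have c2 : ContinuousOn (fun s => v (-(s / 2))) (Icc 0 t) := by
    refine hv.comp (by fun_prop) fun s hs => ?_
    constructor <;> linarith [hs.1, hs.2]
  have i1 : IntervalIntegrable (fun s => v (s / 2)) volume 0 t := c1.intervalIntegrable_of_Icc ht
  have i2 : IntervalIntegrable (fun s => v (-(s / 2))) volume 0 t :=
    c2.intervalIntegrable_of_Icc ht
  refine ⟨(i1.add i2).div_const 2, ?_⟩
  have j1 : IntervalIntegrable v volume (-(t / 2)) 0 :=
    (hv.mono (Icc_subset_Icc (by linarith) (by linarith))).intervalIntegrable_of_Icc (by linarith)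
  have j2 : IntervalIntegrable v volume 0 (t / 2) :=
    (hv.mono (Icc_subset_Icc (by linarith) (by linarith))).intervalIntegrable_of_Icc (by linarith)
  rw [intervalIntegral.integral_div, intervalIntegral.integral_add i1 i2,
    intervalIntegral.integral_comp_div v two_ne_zero,
    intervalIntegral.integral_comp_div (fun s => v (-s)) two_ne_zero,
    intervalIntegral.integral_comp_neg, ← intervalIntegral.integral_add_adjacent_intervals j1 j2]
  simp only [smul_eq_mul, zero_div, neg_zero]
  ring

/-! ### Comparison of the rearranged solution with the symmetric problem. -/

namespace IsZeroMeanNeumannSolution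

variable {f u v : ℝ → ℝ}

/-- Integrating the equation from `x` to `π` gives `½ ∫_{2x}^{2π} f^*`, and `f^*` has zero total
integral. Evenness of the data makes `v'` odd. -/
theorem derivWithin_eq_of_symmDecreasingRearrangement
    (hf : IntegrableOn f (Icc (-Real.pi) Real.pi))
    (hf0 : ∫ x in (-Real.pi)..Real.pi, f x = 0)
    (hv : IsZeroMeanNeumannSolution
      (fun x => (symmDecreasingRearrangement (Icc (-Real.pi) Real.pi) f x).toReal) v)
    {x : ℝ} (hx : x ∈ Ioo 0 Real.pi) :
    derivWithin v (Icc (-Real.pi) Real.pi) x = -(1 / 2) * ∫ s in (0)..(2 * x),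
        (decreasingRearrangement (Icc (-Real.pi) Real.pi) f s).toReal ∧
      derivWithin v (Icc (-Real.pi) Real.pi) (-x) =
        -derivWithin v (Icc (-Real.pi) Real.pi) x := by
  have hL := volume_Icc_neg_pi_pi
  have hpi := Real.pi_pos
  have hX : MeasurableSet (Icc (-Real.pi) Real.pi) := measurableSet_Icc
  set R : ℝ → ℝ := fun s => (decreasingRearrangement (Icc (-Real.pi) Real.pi) f s).toReal with hR
  have hRi : IntervalIntegrable R volume 0 (2 * Real.pi) := by
    rw [intervalIntegrable_iff_integrableOn_Ioo_of_le (by linarith)]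
    exact integrableOn_toReal_decreasingRearrangement hX hL hf
  have hR0 : ∫ s in (0)..(2 * Real.pi), R s = 0 := by
    rw [← integral_Ioo_eq_intervalIntegral (by linarith)]
    refine (integral_comp_toReal_decreasingRearrangement hX hL hf.aemeasurable
      measurable_id).trans ?_
    exact (integral_eq_setIntegral_Icc (by linarith) _).symm.trans hf0
  set fs : ℝ → ℝ := fun x => (symmDecreasingRearrangement (Icc (-Real.pi) Real.pi) f x).toReal
    with hfs
  have hfsR : ∀ y, fs y = R (2 * |y|) := fun _ => rfl
  have e1 := hv.integral_eq_sub (a := x) (b := Real.pi) (by linarith [hx.1]) hx.2.le le_rfl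
  have e2 := hv.integral_eq_sub (a := -Real.pi) (b := -x) le_rfl (by linarith [hx.2])
    (by linarith [hx.1])
  rw [hv.deriv_right, sub_zero] at e1
  rw [hv.deriv_left, zero_sub] at e2
  have e3 : ∫ y in (-Real.pi)..(-x), fs y = ∫ y in x..Real.pi, fs y := by
    rw [← intervalIntegral.integral_comp_neg]
    exact intervalIntegral.integral_congr fun y _ => by simp [hfsR]
  have e4 : ∫ y in x..Real.pi, fs y = ∫ y in x..Real.pi, R (2 * y) := by
    refine intervalIntegral.integral_congr fun y hy => ?_
    rw [uIcc_of_le hx.2.le] at hy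
    simp only [hfsR]
    rw [abs_of_nonneg (hx.1.le.trans hy.1)]
  rw [intervalIntegral.integral_comp_mul_left R two_ne_zero] at e4
  have hx2 : (2 * x) ∈ uIcc 0 (2 * Real.pi) := by
    rw [uIcc_of_le (by linarith)]
    constructor <;> linarith [hx.1, hx.2]
  have e5 := intervalIntegral.integral_add_adjacent_intervals
    (hRi.mono_set (uIcc_subset_uIcc_left hx2)) (hRi.mono_set (uIcc_subset_uIcc_right hx2))
  rw [smul_eq_mul] at e4
  constructor
  · linarith
  · linarith

/-- The integrated comparison between the decreasing rearrangement of `u` and `v`. -/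
theorem integral_decreasingRearrangement_le (hf : IntegrableOn f (Icc (-Real.pi) Real.pi))
    (hf0 : ∫ x in (-Real.pi)..Real.pi, f x = 0)
    (hf1 : ∫ x in (-Real.pi)..Real.pi, x * f x = 0)
    (hu : IsZeroMeanNeumannSolution f u)
    (hv : IsZeroMeanNeumannSolution
      (fun x => (symmDecreasingRearrangement (Icc (-Real.pi) Real.pi) f x).toReal) v)
    {t : ℝ} (ht : t ∈ Ioo 0 (2 * Real.pi)) :
    ∫ s in (0)..t, (decreasingRearrangement (Icc (-Real.pi) Real.pi) u s).toReal ≤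
      ∫ x in (-(t / 2))..(t / 2), v x := by
  have hL := volume_Icc_neg_pi_pi
  have hpi := Real.pi_pos
  have hX : MeasurableSet (Icc (-Real.pi) Real.pi) := measurableSet_Icc
  have hper := hu.apply_pi_eq hf1
  have hui : IntegrableOn u (Icc (-Real.pi) Real.pi) :=
    hu.contDiffOn.continuousOn.integrableOn_Icc
  set F : ℝ → ℝ := fun τ => ∫ s in (0)..τ,
    (decreasingRearrangement (Icc (-Real.pi) Real.pi) f s).toReal with hF
  set R : ℝ → ℝ := fun s => (decreasingRearrangement (Icc (-Real.pi) Real.pi) u s).toReal with hR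
  set w : ℝ → ℝ := fun s => (v (s / 2) + v (-(s / 2))) / 2 with hw
  have hwderiv : ∀ s ∈ Ioo 0 (2 * Real.pi), HasDerivAt w (-(1 / 4) * F s) s := by
    intro s hs
    have hs2 : s / 2 ∈ Ioo 0 Real.pi := by constructor <;> linarith [hs.1, hs.2]
    obtain ⟨d1, d2⟩ := derivWithin_eq_of_symmDecreasingRearrangement hf hf0 hv hs2
    rw [mul_div_cancel₀ s two_ne_zero] at d1
    have a1 := (hv.hasDerivAt (x := s / 2) ⟨by linarith [hs2.1], hs2.2⟩).comp s
      ((hasDerivAt_id s).div_const 2)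
    have a2 := (hv.hasDerivAt (x := -(s / 2)) ⟨by linarith [hs2.2], by linarith [hs2.1]⟩).comp s
      ((hasDerivAt_id s).div_const 2).neg
    refine ((a1.add a2).div_const 2).congr_deriv ?_
    rw [d2, d1]
    ring
  have hFc : UniformContinuousOn F (Icc 0 (2 * Real.pi)) := by
    refine isCompact_Icc.uniformContinuousOn_of_continuous ?_
    have hi : IntegrableOn (fun s =>
        (decreasingRearrangement (Icc (-Real.pi) Real.pi) f s).toReal) (uIcc 0 (2 * Real.pi)) := by
      rw [uIcc_of_le (by linarith), integrableOn_Icc_iff_integrableOn_Ioo]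
      exact integrableOn_toReal_decreasingRearrangement hX hL hf
    have := intervalIntegral.continuousOn_primitive_interval hi
    rwa [uIcc_of_le (by linarith)] at this
  -- No differentiability of `R` is needed: on short intervals `F` varies by less than `ε`, so the
  -- bound for `R` and the mean value theorem for `w` differ by at most `ε(y - x)/2`.
  have hmono : MonotoneOn (fun s => R s - w s) (Ioo 0 (2 * Real.pi)) := by
    refine monotoneOn_of_forall_sub_le fun ε hε => ?_
    obtain ⟨δ, hδ, hFδ⟩ := Metric.uniformContinuousOn_iff.1 hFc ε hε
    refine ⟨δ, hδ, fun x hx y hy hxy hlt => ?_⟩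
    have hclose : ∀ τ ∈ Icc x y, |F τ - F x| < ε := by
      intro τ hτ
      have := hFδ τ ⟨hx.1.le.trans hτ.1, hτ.2.trans hy.2.le⟩ x (Ioo_subset_Icc_self hx) (by
        rw [Real.dist_eq, abs_of_nonneg (by linarith [hτ.1])]
        linarith [hτ.2])
      rwa [Real.dist_eq] at this
    have e1 := hu.four_mul_decreasingRearrangement_sub_le hf hf0 hper (M := F x + ε) hx.1 hxy hy.2
      fun τ hτ => by
        rw [integral_Ioo_eq_intervalIntegral (hx.1.le.trans hτ.1)]
        linarith [(abs_lt.1 (hclose τ hτ)).2]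
    obtain ⟨σ, hσ, e2⟩ := exists_hasDerivAt_eq_slope w (fun s => -(1 / 4) * F s) hxy
      (fun s hs => (hwderiv s ⟨hx.1.trans_le hs.1, hs.2.trans_lt hy.2⟩).continuousAt
        |>.continuousWithinAt)
      (fun s hs => hwderiv s ⟨hx.1.trans hs.1, hs.2.trans hy.2⟩)
    rw [eq_div_iff (by linarith)] at e2
    have e3 := (abs_lt.1 (hclose σ (Ioo_subset_Icc_self hσ))).1
    change 4 * (R x - R y) ≤ _ at e1
    have e4 : 0 ≤ (y - x) * (F σ - F x + ε) := mul_nonneg (by linarith) (by linarith)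
    have e5 : 0 ≤ ε * (y - x) := mul_nonneg hε.le (by linarith)
    nlinarith
  obtain ⟨hwi, hwint⟩ := hv.contDiffOn.continuousOn.integral_half_add_half
    (t := 2 * Real.pi) (by linarith) le_rfl
  obtain ⟨hwi', hwint'⟩ := hv.contDiffOn.continuousOn.integral_half_add_half ht.1.le ht.2.le
  have hRi : IntervalIntegrable R volume 0 (2 * Real.pi) := by
    rw [intervalIntegrable_iff_integrableOn_Ioo_of_le (by linarith)]
    exact integrableOn_toReal_decreasingRearrangement hX hL hui
  have hR0 : ∫ s in (0)..(2 * Real.pi), R s = 0 := by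
    rw [← integral_Ioo_eq_intervalIntegral (by linarith)]
    refine (integral_comp_toReal_decreasingRearrangement hX hL hui.aemeasurable
      measurable_id).trans ?_
    exact (integral_eq_setIntegral_Icc (by linarith) _).symm.trans hu.zero_mean
  have hfin := hmono.integral_nonpos_of_integral_eq_zero (hRi.sub hwi) (by
    rw [intervalIntegral.integral_sub hRi hwi, hR0, hwint, mul_div_cancel_left₀ _ two_ne_zero,
      hv.zero_mean, sub_zero]) ht
  rw [intervalIntegral.integral_sub (hRi.mono_set ?_) hwi', hwint'] at hfin
  · linarith
  · rw [uIcc_of_le ht.1.le, uIcc_of_le (by linarith)]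
    exact Icc_subset_Icc_right ht.2.le

end IsZeroMeanNeumannSolution

theorem theorem3p7 (f u v : ℝ → ℝ)
    (hf : IntegrableOn f (Icc (-Real.pi) Real.pi))
    (hf0 : ∫ x in (-Real.pi)..Real.pi, f x = 0)
    (hf1 : ∫ x in (-Real.pi)..Real.pi, x * f x = 0)
    (hu : IsZeroMeanNeumannSolution f u)
    (hv : IsZeroMeanNeumannSolution
      (fun x => (symmDecreasingRearrangement (Icc (-Real.pi) Real.pi) f x).toReal) v)
    (t : ℝ) (ht : t ∈ Icc 0 (2 * Real.pi)) :
    starFunction (Icc (-Real.pi) Real.pi) u t ≤ ∫ x in (-(t / 2))..(t / 2), v x ∧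
      ∫ x in (-(t / 2))..(t / 2), v x ≤ starFunction (Icc (-Real.pi) Real.pi) v t := by
  have hL := volume_Icc_neg_pi_pi
  have hpi := Real.pi_pos
  have hX : MeasurableSet (Icc (-Real.pi) Real.pi) := measurableSet_Icc
  have hui : IntegrableOn u (Icc (-Real.pi) Real.pi) :=
    hu.contDiffOn.continuousOn.integrableOn_Icc
  have hvi : IntegrableOn v (Icc (-Real.pi) Real.pi) :=
    hv.contDiffOn.continuousOn.integrableOn_Icc
  have hsub : Icc (-(t / 2)) (t / 2) ⊆ Icc (-Real.pi) Real.pi :=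
    Icc_subset_Icc (by linarith [ht.2]) (by linarith [ht.2])
  have hvol : volume (Icc (-(t / 2)) (t / 2)) = ENNReal.ofReal t := by
    rw [Real.volume_Icc]; ring_nf
  constructor
  · refine csSup_le ⟨_, _, measurableSet_Icc, hsub, hvol, rfl⟩ ?_
    rintro _ ⟨E, hE, hEX, hEt, rfl⟩
    -- The bathtub principle needs `0 < t < 2π`. At `t = 0` both integrals vanish; at `t = 2π` the
    -- set `E` is almost the whole interval and both means are zero.
    rcases ht.1.eq_or_lt with rfl | ht0
    · rw [ENNReal.ofReal_zero] at hEt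
      simp [Measure.restrict_eq_zero.2 hEt]
    rcases ht.2.eq_or_lt with rfl | htL
    · have hae : E =ᵐ[volume] Icc (-Real.pi) Real.pi :=
        ae_eq_of_subset_of_measure_ge hEX (by rw [hEt, hL]) hE.nullMeasurableSet (by simp)
      rw [setIntegral_congr_set hae, ← integral_eq_setIntegral_Icc (by linarith), hu.zero_mean,
        mul_div_cancel_left₀ _ two_ne_zero, hv.zero_mean]
    · have h1 := integral_mul_le_integral_decreasingRearrangement hX hL hui
        (φ := E.indicator fun _ => 1) (τ := t)
        ((measurable_const.indicator hE).aestronglyMeasurable)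
        (fun x _ => indicator_nonneg (fun _ _ => zero_le_one) x)
        (fun x _ => indicator_le_self' (fun _ _ => zero_le_one) x) ⟨ht0, htL⟩ (by
          rw [setIntegral_indicator hE, inter_eq_self_of_subset_right hEX]
          simp [Measure.real, hEt, ht0.le])
      have h2 : ∫ x in Icc (-Real.pi) Real.pi, u x * E.indicator (fun _ => 1) x =
          ∫ x in E, u x := by
        simp_rw [← indicator_mul_right, mul_one]
        rw [setIntegral_indicator hE, inter_eq_self_of_subset_right hEX]
      rw [h2, integral_Ioo_eq_intervalIntegral ht0.le] at h1
      exact h1.trans (hu.integral_decreasingRearrangement_le hf hf0 hf1 hv ⟨ht0, htL⟩)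
  -- `∫|v|` is an upper bound, without which the real `sSup` would take its default value.
  · refine le_csSup ⟨∫ x in Icc (-Real.pi) Real.pi, |v x|, ?_⟩
      ⟨_, measurableSet_Icc, hsub, hvol, integral_eq_setIntegral_Icc (by linarith [ht.1]) v⟩
    rintro _ ⟨E, hE, hEX, -, rfl⟩
    calc ∫ x in E, v x ≤ ∫ x in E, |v x| :=
          setIntegral_mono (hvi.mono_set hEX) (hvi.mono_set hEX).abs fun x => le_abs_self _
      _ ≤ ∫ x in Icc (-Real.pi) Real.pi, |v x| :=
          setIntegral_mono_set hvi.abs (Filter.Eventually.of_forall fun x => abs_nonneg _)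
            hEX.eventuallyLE
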